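/- Let $\mathbb S^n\subset\mathbb R^{n+1}$ be the unit sphere with its round metric $can$, and let $\Gamma<\mathrm O(n+1)$ be a finite subgroup. Let $\mathbb S^n/\Gamma$ be the quotient spherical orbifold, with underlying space $|\mathbb S^n/\Gamma|$. Let $\Sigma\subset\mathbb S^n$ be the set of points with non-trivial stabilizer in $\Gamma$. A map $\varphi:|\mathbb S^n/\Gamma|\to\mathbb S^N$ is called PC if it is continuous and piecewise a conformal immersion. That is, let $\tilde\varphi:\mathbb S^n\to\mathbb S^N$ be the composition of $\varphi$ with the quotient map. Then $\mathbb S^n$ is a finite union of closed sets $P_i$, each with boundary covered by finitely many embedded smooth hypersurfaces, and on each $P_i\setminus\Sigma$ the map $\tilde\varphi$ agrees with a smooth conformal immersion into $\mathbb S^N$ defined on an open neighbourhood of $P_i\setminus\Sigma$ in $\mathbb S^n$. Let $\mathrm{M\ddot ob}(\mathbb S^N)$ be the group of Möbius transformations of $\mathbb S^N$, generated by the reflections in the codimension-one round spheres of $\mathbb S^N$. For a map $\psi:|\mathbb S^n/\Gamma|\to\mathbb S^N$ for which the lift $\tilde\psi$ is differentiable almost everywhere, let $$\mathrm{Vol}(\mathbb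 S^n/\Gamma,\psi^*can)=\frac1{|\Gamma|}\int_{\mathbb S^n}\mathrm{dv}_{\tilde\psi^*can}$$ be the volume of the pulled back (almost everywhere defined) metric. Put $$V_{PC}(N,\varphi)=\sup_{\mu\in\mathrm{M\ddot ob}(\mathbb S^N)}\mathrm{Vol}\bigl(\mathbb S^n/\Gamma,(\mu\circ\varphi)^*can\bigr),\qquad V_{PC}(N,\mathbb S^n/\Gamma)=\inf_{\varphi\ \mathrm{PC}}V_{PC}(N,\varphi)\in[0,\infty],$$ where the infimum is over all PC maps $\varphi:|\mathbb S^n/\Gamma|\to\mathbb S^N$ and is $\infty$ if there are none. The piecewise conformal volume of $\mathbb S^n/\Gamma$ is $V_{PC}(\mathbb S^n/\Gamma)=\lim_{N\to\infty}V_{PC}(N,\mathbb S^n/\Gamma)$. Theorem. There is a function $C(n)$ such that for every $n$ and every finite subgroup $\Gamma<\mathrm O(n+1)$, the limit defining $V_{PC}(\mathbb S^n/\Gamma)$ exists and $$V_{PC}(\mathbb S^n/\Gamma)<C(n)\,|\Gamma|^{2n}.$$ -/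

import Mathlib

open scoped Manifold ContDiff ENNReal NNReal Topology

noncomputable section

namespace PCVolume

/-- The Euclidean space `ℝⁿ⁺¹`. -/
abbrev Euc (n : ℕ) : Type := EuclideanSpace ℝ (Fin (n + 1))

/-- The unit sphere `𝕊ⁿ ⊆ ℝⁿ⁺¹`, with Mathlib's topology and smooth structure. -/
abbrev Sph (n : ℕ) : Type := Metric.sphere (0 : Euc n) 1

/-- The orthogonal group `O(n+1)`, as the group of linear isometries of `ℝⁿ⁺¹`. -/
abbrev Orth (n : ℕ) : Type := Euc n ≃ₗᵢ[ℝ] Euc n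

/-- The standard action of `O(n+1)` on `𝕊ⁿ`. -/
instance instMulActionSph (n : ℕ) : MulAction (Orth n) (Sph n) where
  smul γ x := ⟨γ (x : Euc n), by simp⟩
  one_smul _ := rfl
  mul_smul _ _ _ := rfl

/-- The underlying topological space `|𝕊ⁿ/Γ|` of the spherical orbifold `𝕊ⁿ/Γ`: the orbit space
with the quotient topology. The orbifold structure is the one for which the quotient map
`𝕊ⁿ → 𝕊ⁿ/Γ` is a (global) orbifold chart with group `Γ`. -/
abbrev Orbifold {n : ℕ} (Γ : Subgroup (Orth n)) : Type :=
  MulAction.orbitRel.Quotient Γ (Sph n)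

/-- The quotient map `𝕊ⁿ → |𝕊ⁿ/Γ|`. -/
def proj {n : ℕ} (Γ : Subgroup (Orth n)) (x : Sph n) : Orbifold Γ :=
  Quotient.mk _ x

/-- The preimage in `𝕊ⁿ` of the singular locus of `𝕊ⁿ/Γ`: the points with non-trivial
stabilizer. -/
def singularSet {n : ℕ} (Γ : Subgroup (Orth n)) : Set (Sph n) :=
  {x | ∃ γ ∈ Γ, γ ≠ 1 ∧ γ • x = x}

/-- The pullback `f^*(can)` of the round metric of `𝕊ᴺ` under a map `f : 𝕊ⁿ → 𝕊ᴺ`, at the point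
`x`, as a form on the tangent space of `𝕊ⁿ` at `x`. The round metric is the one that `𝕊ᴺ` inherits
from `ℝᴺ⁺¹`. -/
def pullbackCan {n N : ℕ} (f : Sph n → Sph N) (x : Sph n) (u v : TangentSpace (𝓡 n) x) : ℝ :=
  inner ℝ (mvfderiv (𝓡 n) (fun y : Sph n => (f y : Euc N)) x u)
    (mvfderiv (𝓡 n) (fun y : Sph n => (f y : Euc N)) x v)

/-- The round metric `can` of `𝕊ⁿ`. -/
def can {n : ℕ} (x : Sph n) (u v : TangentSpace (𝓡 n) x) : ℝ :=
  pullbackCan (id : Sph n → Sph n) x u v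

/-- `f` is a (smooth) conformal immersion on the set `U`: the pullback of the round metric is a
positive multiple of the round metric at each point of `U`. -/
structure IsConformalImmersionOn {n N : ℕ} (f : Sph n → Sph N) (U : Set (Sph n)) : Prop where
  smooth : ContMDiffOn (𝓡 n) (𝓡 N) ∞ f U
  conformal : ∀ x ∈ U, ∃ c : ℝ, 0 < c ∧
    ∀ u v : TangentSpace (𝓡 n) x, pullbackCan f x u v = c * can x u v

/-- An embedded smooth hypersurface of `𝕊ⁿ` given by one regular equation on an open set. -/
def IsSmoothHypersurface {n : ℕ} (Z : Set (Sph n)) : Prop :=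
  ∃ (V : Set (Sph n)) (g : Sph n → ℝ), IsOpen V ∧ ContMDiffOn (𝓡 n) 𝓘(ℝ, ℝ) ∞ g V ∧
    Z = {x ∈ V | g x = 0} ∧ ∀ x ∈ Z, mvfderiv (𝓡 n) g x ≠ 0

/-- A piece: a closed subset of `𝕊ⁿ` whose boundary is covered by finitely many smooth
hypersurfaces. -/
structure IsPiece {n : ℕ} (P : Set (Sph n)) : Prop where
  isClosed : IsClosed P
  boundary : ∃ (k : ℕ) (Z : Fin k → Set (Sph n)),
    (∀ j, IsSmoothHypersurface (Z j)) ∧ frontier P ⊆ ⋃ j, Z j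

/-- PC maps `φ : |𝕊ⁿ/Γ| → 𝕊ᴺ`: continuous maps that are piecewise a conformal immersion. That is,
the chart `𝕊ⁿ` is a union of finitely many pieces, and on each piece, away from the singular locus,
the map that `φ` induces on `𝕊ⁿ` agrees with a conformal immersion defined on a
neighbourhood. -/
structure IsPC {n N : ℕ} (Γ : Subgroup (Orth n)) (φ : Orbifold Γ → Sph N) : Prop where
  continuous : Continuous φ
  piecewise : ∃ (k : ℕ) (P : Fin k → Set (Sph n)),
    (∀ i, IsPiece (P i)) ∧ (⋃ i, P i) = Set.univ ∧
    ∀ i, ∃ (U : Set (Sph n)) (f : Sph n → Sph N),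
      IsOpen U ∧ P i \ singularSet Γ ⊆ U ∧ IsConformalImmersionOn f U ∧
      ∀ x ∈ P i \ singularSet Γ, φ (proj Γ x) = f x

/-- The density `√(det hᵢⱼ / det gᵢⱼ)` at `x` of the volume form of the pullback metric
`h = f^*(can)` with respect to that of the round metric `g = can` of `𝕊ⁿ`. The matrices are taken
in the standard basis of Mathlib's tangent space at `x`; the quotient does not depend on the
basis. -/
def volumeDensity {n N : ℕ} (f : Sph n → Sph N) (x : Sph n) : ℝ :=
  let e : Fin n → TangentSpace (𝓡 n) x := fun i => EuclideanSpace.single i (1 : ℝ)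
  √((Matrix.of fun i j : Fin n => pullbackCan f x (e i) (e j)).det /
    (Matrix.of fun i j : Fin n => can x (e i) (e j)).det)

/-- The orbifold volume `Vol(𝕊ⁿ/Γ, φ^*(can))` of the (almost everywhere defined) pullback metric
under `φ : |𝕊ⁿ/Γ| → 𝕊ᴺ`: the integral over the chart `𝕊ⁿ`, with its surface measure, divided by
the order of the group. -/
def pullbackVolume {n N : ℕ} (Γ : Subgroup (Orth n)) (φ : Orbifold Γ → Sph N) : ℝ≥0∞ :=
  (∫⁻ x : Sph n, ENNReal.ofReal (volumeDensity (fun y => φ (proj Γ y)) x)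
    ∂(MeasureTheory.volume : MeasureTheory.Measure (Euc n)).toSphere) / (Nat.card Γ : ℝ≥0∞)

/-- `σ` is the reflection of `𝕊ᴺ` in a codimension-one sphere of `𝕊ᴺ`: in a great sphere (first
case), or in the sphere of points of tangency of the cone with apex `a` outside the ball, which is
the restriction to `𝕊ᴺ` of the inversion of `ℝᴺ⁺¹` in the sphere with centre `a` that is
orthogonal to `𝕊ᴺ`. -/
def IsSphereReflection {N : ℕ} (σ : Equiv.Perm (Sph N)) : Prop :=
  (∃ a : Euc N, a ≠ 0 ∧ ∀ x : Sph N, (σ x : Euc N) = (ℝ ∙ a)ᗮ.reflection (x : Euc N)) ∨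
  (∃ a : Euc N, 1 < ‖a‖ ∧
    ∀ x : Sph N, (σ x : Euc N) = EuclideanGeometry.inversion a √(‖a‖ ^ 2 - 1) (x : Euc N))

/-- The Möbius group `Möb(𝕊ᴺ)`, generated by the reflections in codimension-one spheres. -/
def Moeb (N : ℕ) : Subgroup (Equiv.Perm (Sph N)) :=
  Subgroup.closure {σ | IsSphereReflection σ}

/-- `V_PC(N, φ) = sup_{μ ∈ Möb(𝕊ᴺ)} Vol(𝕊ⁿ/Γ, (μ ∘ φ)^*(can))`. -/
def mapPCVolume {n N : ℕ} (Γ : Subgroup (Orth n)) (φ : Orbifold Γ → Sph N) : ℝ≥0∞ :=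
  ⨆ μ ∈ Moeb N, pullbackVolume Γ (fun p => μ (φ p))

/-- `V_PC(N, 𝕊ⁿ/Γ) = inf V_PC(N, φ)` over the PC maps `φ : |𝕊ⁿ/Γ| → 𝕊ᴺ` (`∞` if there are
none). -/
def dimPCVolume {n : ℕ} (N : ℕ) (Γ : Subgroup (Orth n)) : ℝ≥0∞ :=
  ⨅ (φ : Orbifold Γ → Sph N) (_ : IsPC Γ φ), mapPCVolume Γ φ

/-- The piecewise conformal volume `V_PC(𝕊ⁿ/Γ) = lim_{N → ∞} V_PC(N, 𝕊ⁿ/Γ)`. -/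
def pcVolume {n : ℕ} (Γ : Subgroup (Orth n)) : ℝ≥0∞ :=
  Filter.limUnder Filter.atTop fun N : ℕ => dimPCVolume N Γ

end PCVolume

end

/-!
The bound comes from an explicit piecewise isometric map of `𝕊ⁿ/Γ`. For each coordinate `i`, list
the numbers `(γ x)ᵢ`, `γ ∈ Γ`, in increasing order. The resulting `(n + 1) |Γ|` numbers are
continuous in `x` and invariant under `Γ`, and the sum of their squares is `|Γ| ‖x‖²`
(`sortedMap`). The order is constant on each chamber of the arrangement of the hyperplanes
`(γ x)ᵢ = (δ x)ᵢ`, and there the map, divided by `√|Γ|`, is the restriction of a linear isometry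
`ℝⁿ⁺¹ → ℝᴺ⁺¹`. So it is a PC map, whose pieces lie in great `n`-spheres (`isPC_orbifoldSortedMap`).

A Möbius transformation sends a great `n`-sphere to a round `n`-sphere, of volume bounded by a
constant that depends only on `n` (`IsLorentzLift.lintegral_le`). The volume of the image of the
sorting map is therefore bounded by a constant times the number of chambers
(`lintegral_volumeDensity_sortedMap_le`). There are at most `(n + 1) |Γ|²` hyperplanes in `ℝⁿ⁺¹`,
all passing through the origin, and the Sauer–Shelah lemma, applied to the sign patterns on each
side of one more hyperplane (`vcDim_halfSpacePatterns_le`), bounds the number of chambers by a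
constant times `|Γ|²ⁿ`.

Möbius transformations are handled through the linear maps of `ℝᴺ⁺¹ × ℝ` that preserve the
Lorentzian form and induce them on the light cone (`IsLorentzLift`). They multiply the pullback
metric by the inverse square of an affine function `c + ⟨α, x⟩` with `c² ≥ 1 + ‖α‖²`
(`IsLorentzLift.pullbackCan_comp`, `IsLorentzLift.exists_affine`).

The limit exists because `V_PC(N, 𝕊ⁿ/Γ)` is antitone in `N` (`antitone_dimPCVolume`): after the
inclusion `𝕊ᴺ ⊂ 𝕊ᴺ⁺¹`, the Möbius transformations of `𝕊ᴺ⁺¹` do not produce more volume than those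
of `𝕊ᴺ`, whose conformal factors dominate (`exists_moeb_le`).
-/

noncomputable section

namespace PCVolume

open MeasureTheory

/-! ### Volumes of conformal images of the sphere -/

/-- Integration of `‖T x‖⁻⁽ⁿ⁺¹⁾` over the sphere: this is, up to the factor `n + 1`, the volume in
polar coordinates of the ellipsoid `‖T y‖ < 1`. -/
lemma lintegral_sphere_norm_inv_pow {n : ℕ} (T : Euc n →ₗ[ℝ] Euc n) (hT : LinearMap.det T ≠ 0) :
    ∫⁻ x : Sph n, ENNReal.ofReal ((‖T x‖⁻¹) ^ (n + 1)) ∂(volume : Measure (Euc n)).toSphere =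
      ENNReal.ofReal |(LinearMap.det T)⁻¹| * (volume : Measure (Euc n)).toSphere Set.univ := by
  have hinj : Function.Injective T := (LinearMap.equivOfDetNeZero T hT).injective
  have hTc : Continuous T := T.continuous_of_finiteDimensional
  have hpos : ∀ x : Sph n, 0 < ‖T x‖ := fun x => by
    rw [norm_pos_iff, Ne, map_eq_zero_iff T hinj]
    exact ne_zero_of_mem_unit_sphere x
  have hdim : Module.finrank ℝ (Euc n) = n + 1 := by simp
  set S : Set (Euc n) := T ⁻¹' Metric.ball 0 1 with hS
  have h1 : (volume : Measure (Euc n)) S =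
      ENNReal.ofReal |(LinearMap.det T)⁻¹| * volume (Metric.ball (0 : Euc n) 1) :=
    Measure.addHaar_preimage_linearMap _ hT _
  let W : Set (Sph n × Set.Ioi (0 : ℝ)) := {p | p.2.1 * ‖T p.1‖ < 1}
  have hW : MeasurableSet W := by
    apply IsOpen.measurableSet
    apply isOpen_lt _ continuous_const
    fun_prop
  have h2 : (volume : Measure (Euc n)) S =
      ((volume : Measure (Euc n)).toSphere.prod (Measure.volumeIoiPow n)) W := by
    have hmp := (volume : Measure (Euc n)).measurePreserving_homeomorphUnitSphereProd
    rw [hdim, Nat.add_sub_cancel] at hmp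
    rw [← hmp.measure_preimage hW.nullMeasurableSet,
      comap_subtype_coe_apply (measurableSet_singleton _).compl]
    have : (Subtype.val '' ((homeomorphUnitSphereProd (Euc n)) ⁻¹' W)) = S \ {0} := by
      ext y
      simp only [Set.mem_image, Set.mem_preimage, Subtype.exists, exists_and_right,
        exists_eq_right, Set.mem_sdiff, Set.mem_singleton_iff, W, Set.mem_ofPred_eq, hS,
        mem_ball_zero_iff]
      have key : ∀ hy : y ≠ 0, ‖y‖ * ‖T (‖y‖⁻¹ • y)‖ = ‖T y‖ := fun hy => by
        have : ‖y‖ ≠ 0 := norm_ne_zero_iff.2 hy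
        rw [map_smul, norm_smul, norm_inv, norm_norm]
        field_simp
      constructor
      · rintro ⟨hy, h⟩
        refine ⟨?_, hy⟩
        rw [← key hy]
        simpa using h
      · rintro ⟨h, hy⟩
        refine ⟨hy, ?_⟩
        rw [← key hy] at h
        simpa using h
    rw [this, measure_sdiff_null (measure_singleton _)]
  have h3 : ((volume : Measure (Euc n)).toSphere.prod (Measure.volumeIoiPow n)) W =
      ∫⁻ x : Sph n, ENNReal.ofReal ((‖T x‖⁻¹) ^ (n + 1) / (n + 1))
        ∂(volume : Measure (Euc n)).toSphere := by
    rw [Measure.prod_apply hW]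
    refine lintegral_congr fun x => ?_
    rw [← Measure.volumeIoiPow_apply_Iio n ⟨‖T x‖⁻¹, inv_pos.2 (hpos x)⟩]
    congr 1
    ext r
    simp only [W, Set.mem_preimage, Set.mem_ofPred_eq, Set.mem_Iio, ← Subtype.coe_lt_coe]
    rw [lt_inv_comm₀ r.2 (hpos x), inv_eq_one_div, lt_div_iff₀ r.2, mul_comm]
  rw [Measure.toSphere_apply_univ, hdim, mul_left_comm, ← h1, h2, h3,
    ← lintegral_const_mul _ (by fun_prop)]
  refine lintegral_congr fun x => ?_
  rw [← ENNReal.ofReal_natCast, ← ENNReal.ofReal_mul (by positivity)]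
  congr 1
  push_cast
  field_simp

/-- The integrand is the volume density of a conformal map of `𝕊ⁿ` onto a round `n`-sphere, whose
volume is thus bounded independently of the map. With `b ≤ c` and `b² = 1 + ‖d‖²`, one has
`(b + ⟨d, x⟩)⁻¹ = (b - ⟨d, x⟩) / (b² - ⟨d, x⟩²)`, and on `𝕊ⁿ` the denominator is `‖T x‖²` for a
linear map `T` with `det T = bⁿ` and `‖T x‖ ≥ 1`. So for `n ≥ 1` the integrand is at most
`2ⁿ det T / ‖T x‖ⁿ⁺¹`, whose integral is `2ⁿ` times the volume of `𝕊ⁿ`. -/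
lemma lintegral_sphere_conformal_factor_le {n : ℕ} (c : ℝ) (d : Euc n) (hc : 0 < c)
    (hcd : 1 + ‖d‖ ^ 2 ≤ c ^ 2) :
    ∫⁻ x : Sph n, ENNReal.ofReal ((c + inner ℝ d (x : Euc n))⁻¹ ^ n)
        ∂(volume : Measure (Euc n)).toSphere ≤
      2 ^ n * (volume : Measure (Euc n)).toSphere Set.univ := by
  rcases Nat.eq_zero_or_pos n with rfl | hn
  · simp
  -- It suffices to treat the least admissible value `b` of `c`.
  set b : ℝ := √(1 + ‖d‖ ^ 2) with hb
  have hb2 : b ^ 2 = 1 + ‖d‖ ^ 2 := Real.sq_sqrt (by positivity)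
  have hb1 : 1 ≤ b := by
    rw [hb, Real.one_le_sqrt]; nlinarith [sq_nonneg ‖d‖]
  have hbc : b ≤ c := by
    rw [hb]; exact Real.sqrt_le_iff.2 ⟨hc.le, hcd⟩
  have hdb : ‖d‖ < b := by
    apply lt_of_pow_lt_pow_left₀ 2 (by linarith); linarith
  -- `T y = b y - (b + 1)⁻¹ ⟨d, y⟩ d` multiplies the vectors orthogonal to `d` by `b` and fixes `d`.
  let T : Euc n →ₗ[ℝ] Euc n :=
    b • LinearMap.transvection (innerₛₗ ℝ d) (-(b * (b + 1))⁻¹ • d)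
  have hT : ∀ y, ‖T y‖ ^ 2 = b ^ 2 * ‖y‖ ^ 2 - inner ℝ d y ^ 2 := fun y => by
    have h : T y = b • y - ((b + 1)⁻¹ * inner ℝ d y) • d := by
      simp only [T, LinearMap.smul_apply, LinearMap.transvection.apply, innerₛₗ_apply_apply,
        smul_add, smul_smul, sub_eq_add_neg, ← neg_smul]
      congr 2
      field_simp
    have hd2 : ‖d‖ ^ 2 = b ^ 2 - 1 := by linarith
    rw [h, norm_sub_sq_real, norm_smul, norm_smul, inner_smul_left, inner_smul_right,
      real_inner_comm, mul_pow, mul_pow, hd2]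
    simp only [Real.norm_eq_abs, sq_abs, conj_trivial]
    field_simp
    ring
  have hdet : LinearMap.det T = b ^ n := by
    have hd2 : inner ℝ d d = b ^ 2 - 1 := by rw [real_inner_self_eq_norm_sq]; linarith
    simp only [T, LinearMap.det_smul, LinearMap.transvection.det, map_smul, innerₛₗ_apply_apply, hd2,
      finrank_euclideanSpace, Fintype.card_fin, smul_eq_mul]
    field_simp
    ring
  have hdet0 : LinearMap.det T ≠ 0 := by rw [hdet]; positivity
  have key : ∀ x : Sph n, (c + inner ℝ d (x : Euc n))⁻¹ ^ n ≤
      2 ^ n * b ^ n * (‖T x‖⁻¹) ^ (n + 1) := fun x => by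
    have hx : ‖(x : Euc n)‖ = 1 := by simp
    have habs : |inner ℝ d (x : Euc n)| ≤ ‖d‖ := by
      simpa [hx] using abs_real_inner_le_norm d (x : Euc n)
    obtain ⟨hl, hr⟩ := abs_le.1 habs
    have hTx := hT x
    rw [hx] at hTx
    set t := inner ℝ d (x : Euc n)
    have hT1 : 1 ≤ ‖T x‖ := by
      have : t ^ 2 ≤ ‖d‖ ^ 2 := sq_le_sq' hl hr
      refine (one_le_sq_iff₀ (norm_nonneg _)).1 ?_
      linarith
    have hbt : 0 < b + t := by linarith
    have h1 : (c + t)⁻¹ ≤ 2 * b * (‖T x‖⁻¹) ^ 2 := by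
      have hTx' : ‖T x‖ ^ 2 = (b + t) * (b - t) := by rw [hTx]; ring
      have hb' : 0 < b - t := by linarith
      calc (c + t)⁻¹ ≤ (b + t)⁻¹ := inv_anti₀ hbt (by linarith)
        _ = (b - t) * (‖T x‖⁻¹) ^ 2 := by rw [inv_pow, hTx']; field_simp
        _ ≤ _ := by gcongr; linarith
    calc (c + t)⁻¹ ^ n ≤ (2 * b * (‖T x‖⁻¹) ^ 2) ^ n :=
          pow_le_pow_left₀ (inv_nonneg.2 (by linarith)) h1 n
      _ = 2 ^ n * b ^ n * (‖T x‖⁻¹) ^ (2 * n) := by rw [mul_pow, mul_pow, pow_mul]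
      _ ≤ _ := by
        exact mul_le_mul_of_nonneg_left
          (pow_le_pow_of_le_one (by positivity) (inv_le_one_of_one_le₀ hT1)
            (by omega : n + 1 ≤ 2 * n)) (by positivity)
  calc _ ≤ ∫⁻ x : Sph n, ENNReal.ofReal (2 ^ n * b ^ n) * ENNReal.ofReal ((‖T x‖⁻¹) ^ (n + 1))
        ∂(volume : Measure (Euc n)).toSphere := by
        refine lintegral_mono fun x => ?_
        rw [← ENNReal.ofReal_mul (by positivity)]
        exact ENNReal.ofReal_le_ofReal (key x)
    _ = _ := by
        rw [lintegral_const_mul' _ _ ENNReal.ofReal_ne_top, lintegral_sphere_norm_inv_pow T hdet0,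
          ← mul_assoc, ← ENNReal.ofReal_mul (by positivity), hdet, abs_of_pos (by positivity),
          mul_assoc, mul_inv_cancel₀ (by positivity), mul_one]
        congr 1
        rw [ENNReal.ofReal_pow (by norm_num)]
        norm_num

/-! ### Maps induced by Lorentzian linear maps -/

/-- The Lorentzian quadratic form `‖y‖² - t²` on `ℝᴺ⁺¹ × ℝ`. -/
def lorentzForm {N : ℕ} (v : Euc N × ℝ) : ℝ := ‖v.1‖ ^ 2 - v.2 ^ 2

/-- The linear map `A` preserves the Lorentzian forms and, on the light cone over `𝕊ᴺ` (the sphere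
being the section `t = 1`), induces the map `F`. Both Möbius
transformations and their restrictions to great spheres have such lifts. -/
structure IsLorentzLift {N M : ℕ} (A : Euc N × ℝ →ₗ[ℝ] Euc M × ℝ) (F : Sph N → Sph M) :
    Prop where
  form : ∀ v, lorentzForm (A v) = lorentzForm v
  pos : ∀ x : Sph N, 0 < (A (x, 1)).2
  map : ∀ x : Sph N, A (x, 1) = (A (x, 1)).2 • ((F x : Euc M), (1 : ℝ))

namespace IsLorentzLift

variable {N M K : ℕ} {A : Euc N × ℝ →ₗ[ℝ] Euc M × ℝ} {F : Sph N → Sph M}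

lemma comp {A' : Euc M × ℝ →ₗ[ℝ] Euc K × ℝ} {F' : Sph M → Sph K}
    (h' : IsLorentzLift A' F') (h : IsLorentzLift A F) :
    IsLorentzLift (A' ∘ₗ A) (F' ∘ F) := by
  have key : ∀ x : Sph N, (A' ∘ₗ A) (x, 1) =
      ((A (x, 1)).2 * (A' (F x, 1)).2) • ((F' (F x) : Euc K), (1 : ℝ)) := fun x => by
    rw [LinearMap.comp_apply, h.map x, map_smul, h'.map (F x), smul_smul]
    simp
  refine ⟨fun v => (h'.form _).trans (h.form v), fun x => ?_, fun x => ?_⟩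
  · rw [key]
    simpa using mul_pos (h.pos x) (h'.pos (F x))
  · rw [key]
    simp

lemma bilin (h : IsLorentzLift A F) (v w : Euc N × ℝ) :
    inner ℝ (A v).1 (A w).1 - (A v).2 * (A w).2 = inner ℝ v.1 w.1 - v.2 * w.2 := by
  have h1 := h.form (v + w)
  have h2 := h.form v
  have h3 := h.form w
  simp only [lorentzForm, map_add, Prod.fst_add, Prod.snd_add, norm_add_sq_real] at h1 h2 h3
  linarith

lemma injective (h : IsLorentzLift A F) : Function.Injective A := by
  rw [injective_iff_map_eq_zero]
  intro v hv
  have h1 := h.bilin v (v.1, 0)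
  have h2 := h.bilin v (0, v.2)
  simp only [hv, Prod.fst_zero, Prod.snd_zero, inner_zero_left, zero_mul, sub_zero, mul_zero,
    inner_zero_right, zero_sub] at h1 h2
  ext1
  · exact inner_self_eq_zero.1 h1.symm
  · have : v.2 * v.2 = 0 := by linarith
    simpa using this

/-- The dilatation coefficient `s(x) = (A (x, 1)).2` is an affine function `c + ⟨α, x⟩`, and
`(c, α)` is timelike with `c² - ‖α‖² ≥ 1`. Equality holds if `A` is invertible, but not in
general for the restriction of a Möbius transformation to a great sphere. -/
lemma exists_affine (h : IsLorentzLift A F) :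
    ∃ (c : ℝ) (α : Euc N), 0 < c ∧ 1 + ‖α‖ ^ 2 ≤ c ^ 2 ∧
      ∀ v : Euc N × ℝ, (A v).2 = c * v.2 + inner ℝ α v.1 := by
  let f : Euc N →ₗ[ℝ] ℝ := LinearMap.snd ℝ _ _ ∘ₗ A ∘ₗ LinearMap.inl ℝ _ _
  let α : Euc N := (InnerProductSpace.toDual ℝ (Euc N)).symm f.toContinuousLinearMap
  have hα : ∀ y : Euc N, (A (y, 0)).2 = inner ℝ α y := fun y => by
    simp [α, f]
  set c := (A (0, 1)).2 with hc
  have hs : ∀ v : Euc N × ℝ, (A v).2 = c * v.2 + inner ℝ α v.1 := fun v => by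
    obtain ⟨y, t⟩ := v
    have : ((y, t) : Euc N × ℝ) = (y, 0) + t • (0, 1) := by ext <;> simp
    rw [this, map_add, map_smul, Prod.snd_add, hα, Prod.smul_snd, ← hc, smul_eq_mul]
    simp only [Prod.snd_add, Prod.fst_add, Prod.smul_snd, Prod.smul_fst, smul_zero, add_zero,
      zero_add, smul_eq_mul, mul_one]
    ring
  have hαc : ‖α‖ < c := by
    by_cases h0 : α = 0
    · have := h.pos ⟨EuclideanSpace.single 0 1, by simp⟩
      rw [hs] at this
      simpa [h0] using this
    · have hn : ‖α‖ ≠ 0 := norm_ne_zero_iff.2 h0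
      have := h.pos ⟨-(‖α‖⁻¹ • α), by simp [norm_smul, hn]⟩
      rw [hs] at this
      simp only [mul_one, inner_neg_right, inner_smul_right, real_inner_self_eq_norm_sq] at this
      have h2 : ‖α‖⁻¹ * ‖α‖ ^ 2 = ‖α‖ := by field_simp
      linarith
  have hα0 := norm_nonneg α
  refine ⟨c, α, by linarith, ?_, hs⟩
  -- The vector `(α, -c)` represents the last coordinate of `A` with respect to the form. Its value
  -- is `-q` for `q = c² - ‖α‖²`, and so is the last coordinate of its image. Hence
  -- `0 ≤ q² - q`, and `q ≥ 1` since `q > 0`.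
  have h1 := h.form (α, -c)
  have h2 := hs (α, -c)
  simp only [real_inner_self_eq_norm_sq] at h2
  simp only [lorentzForm, h2] at h1
  have h3 : 0 < c ^ 2 - ‖α‖ ^ 2 := by nlinarith
  have h4 : 0 ≤ ‖(A (α, -c)).1‖ ^ 2 := by positivity
  nlinarith

end IsLorentzLift

/-- Chain rule for vector-valued maps on the sphere. -/
lemma mvfderiv_fderiv_comp {n : ℕ} {E E' : Type*} [NormedAddCommGroup E] [NormedSpace ℝ E]
    [NormedAddCommGroup E'] [NormedSpace ℝ E'] {g : Sph n → E} {G : E → E'} {G' : E →L[ℝ] E'}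
    {x : Sph n} (hG : HasFDerivAt G G' (g x)) (hg : MDifferentiableAt (𝓡 n) 𝓘(ℝ, E) g x)
    (u : TangentSpace (𝓡 n) x) :
    mvfderiv (𝓡 n) (fun y => G (g y)) x u = G' (mvfderiv (𝓡 n) g x u) := by
  have h := (hG.hasMFDerivAt.comp x hg.hasMFDerivAt).mfderiv
  have h2 := congrArg (fun L => L u) h
  exact h2

/-- The map `y ↦ [A (y, 1)]` in the affine chart `t = 1`. -/
def projMap {N M : ℕ} (A : Euc N × ℝ →ₗ[ℝ] Euc M × ℝ) (y : Euc N) : Euc M :=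
  (A (y, 1)).2⁻¹ • (A (y, 1)).1

lemma hasFDerivAt_projMap {N M : ℕ} (A : Euc N × ℝ →ₗ[ℝ] Euc M × ℝ) {y : Euc N}
    (hy : (A (y, 1)).2 ≠ 0) :
    ∃ G' : Euc N →L[ℝ] Euc M, HasFDerivAt (projMap A) G' y ∧ ∀ v, G' v =
      (A (y, 1)).2⁻¹ • ((A (v, 0)).1 - (A (v, 0)).2 • projMap A y) := by
  let P : Euc N →L[ℝ] Euc M :=
    (LinearMap.fst ℝ _ _ ∘ₗ A ∘ₗ LinearMap.inl ℝ _ _).toContinuousLinearMap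
  let s : Euc N →L[ℝ] ℝ :=
    (LinearMap.snd ℝ _ _ ∘ₗ A ∘ₗ LinearMap.inl ℝ _ _).toContinuousLinearMap
  have hA : ∀ z, A (z, 1) = (P z, s z) + A (0, 1) := fun z => by
    have : A (z, 1) = A (z, 0) + A (0, 1) := by rw [← map_add]; simp
    rw [this]
    simp [P, s]
  have hP : HasFDerivAt (fun z => (A (z, 1)).1) P y :=
    (P.hasFDerivAt.add_const (A (0, 1)).1).congr_of_eventuallyEq
      (.of_forall fun z => congrArg Prod.fst (hA z))
  have hs : HasFDerivAt (fun z => (A (z, 1)).2) s y :=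
    (s.hasFDerivAt.add_const (A (0, 1)).2).congr_of_eventuallyEq
      (.of_forall fun z => congrArg Prod.snd (hA z))
  have hi := (hasDerivAt_inv hy).comp_hasFDerivAt y hs
  refine ⟨_, hi.smul hP, fun v => ?_⟩
  have hPv : (A (v, 0)).1 = P v := by simp [P]
  have hsv : (A (v, 0)).2 = s v := by simp [s]
  simp only [hPv, hsv, projMap, _root_.add_apply, _root_.smul_apply,
    ContinuousLinearMap.smulRight_apply, smul_sub, smul_smul, Function.comp_apply, smul_eq_mul]
  rw [sub_eq_add_neg, ← neg_smul]
  congr 2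
  field_simp

/-- The differential of a map to the sphere takes values in the tangent space. -/
lemma inner_mvfderiv_eq_zero {n N : ℕ} (h : Sph n → Sph N) {x : Sph n}
    (hd : MDifferentiableAt (𝓡 n) 𝓘(ℝ, Euc N) (fun y => (h y : Euc N)) x)
    (u : TangentSpace (𝓡 n) x) :
    inner ℝ (h x : Euc N) (mvfderiv (𝓡 n) (fun y => (h y : Euc N)) x u) = 0 := by
  have h1 := mvfderiv_fderiv_comp (g := fun y => (h y : Euc N))
    (hasStrictFDerivAt_norm_sq (h x : Euc N)).hasFDerivAt hd u
  have h2 : (fun y : Sph n => ‖(h y : Euc N)‖ ^ 2) = fun _ => (1 : ℝ) := by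
    funext y; simp
  rw [h2, mvfderiv_const] at h1
  simpa using h1

lemma pullbackCan_of_not_mdifferentiableAt {n N : ℕ} {h : Sph n → Sph N} {x : Sph n}
    (hd : ¬ MDifferentiableAt (𝓡 n) 𝓘(ℝ, Euc N) (fun y => (h y : Euc N)) x)
    (u v : TangentSpace (𝓡 n) x) : pullbackCan h x u v = 0 := by
  simp [pullbackCan, mvfderiv, mfderiv_zero_of_not_mdifferentiableAt hd]

lemma volumeDensity_of_pullbackCan_eq {n N M : ℕ} {f : Sph n → Sph N} {h : Sph n → Sph M}
    {x : Sph n} {a : ℝ} (ha : 0 ≤ a)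
    (H : ∀ u v : TangentSpace (𝓡 n) x, pullbackCan f x u v = a ^ 2 * pullbackCan h x u v) :
    volumeDensity f x = a ^ n * volumeDensity h x := by
  let e : Fin n → TangentSpace (𝓡 n) x := fun i => EuclideanSpace.single i (1 : ℝ)
  have h1 : (Matrix.of fun i j : Fin n => pullbackCan f x (e i) (e j)) =
      (a ^ 2) • Matrix.of fun i j : Fin n => pullbackCan h x (e i) (e j) := by
    ext i j
    exact H _ _
  change √((Matrix.of fun i j : Fin n => pullbackCan f x (e i) (e j)).det / _) =
    a ^ n * √((Matrix.of fun i j : Fin n => pullbackCan h x (e i) (e j)).det / _)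
  rw [h1, Matrix.det_smul, Fintype.card_fin, ← pow_mul, mul_comm 2 n, pow_mul, mul_div_assoc,
    Real.sqrt_mul (by positivity), Real.sqrt_sq (by positivity)]

namespace IsLorentzLift

variable {N M : ℕ} {A : Euc N × ℝ →ₗ[ℝ] Euc M × ℝ} {F : Sph N → Sph M}

lemma coe_eq_projMap (hA : IsLorentzLift A F) (x : Sph N) : (F x : Euc M) = projMap A x := by
  have h1 := congrArg Prod.fst (hA.map x)
  rw [projMap, h1, Prod.smul_fst, smul_smul, inv_mul_cancel₀ (hA.pos x).ne', one_smul]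

lemma mdifferentiableAt_comp_iff (hA : IsLorentzLift A F) {n : ℕ} (h : Sph n → Sph N)
    (x : Sph n) :
    MDifferentiableAt (𝓡 n) 𝓘(ℝ, Euc M) (fun y => (F (h y) : Euc M)) x ↔
      MDifferentiableAt (𝓡 n) 𝓘(ℝ, Euc N) (fun y => (h y : Euc N)) x := by
  constructor
  · intro hd
    -- A left inverse of `A` induces a smooth left inverse of `F`.
    obtain ⟨B, hB⟩ := A.exists_leftInverse_of_injective (LinearMap.ker_eq_bot.2 hA.injective)
    have hB' : ∀ z : Sph N, B (F z, 1) = (A (z, 1)).2⁻¹ • ((z : Euc N), (1 : ℝ)) := fun z => by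
      have h1 := congrArg B (hA.map z)
      rw [← LinearMap.comp_apply, hB, map_smul, LinearMap.id_apply] at h1
      rw [eq_inv_smul_iff₀ (hA.pos z).ne', ← h1]
    have hne : ∀ z : Sph N, (B (F z, 1)).2 ≠ 0 := fun z => by
      rw [hB']; simpa using (hA.pos z).ne'
    have h2 : (fun y => (h y : Euc N)) = fun y => projMap B (F (h y)) := by
      funext y
      rw [projMap, hB']
      simp [smul_smul, (hA.pos (h y)).ne']
    rw [h2]
    obtain ⟨G', hG, -⟩ := hasFDerivAt_projMap B (hne (h x))
    exact hG.differentiableAt.mdifferentiableAt.comp (f := fun y => (F (h y) : Euc M)) x hd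
  · intro hd
    simp only [hA.coe_eq_projMap]
    obtain ⟨G', hG, -⟩ := hasFDerivAt_projMap A (hA.pos (h x)).ne'
    exact hG.differentiableAt.mdifferentiableAt.comp (f := fun y => (h y : Euc N)) x hd

/-- Maps with a Lorentzian lift are conformal, with factor `s⁻²`. No regularity of `h` is needed:
at the points where `h` is not differentiable, `F ∘ h` is not differentiable either, and both sides
vanish. -/
lemma pullbackCan_comp (hA : IsLorentzLift A F) {n : ℕ} (h : Sph n → Sph N)
    (x : Sph n) (u v : TangentSpace (𝓡 n) x) :
    pullbackCan (fun y => F (h y)) x u v =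
      ((A (h x, 1)).2⁻¹) ^ 2 * pullbackCan h x u v := by
  by_cases hd : MDifferentiableAt (𝓡 n) 𝓘(ℝ, Euc N) (fun y => (h y : Euc N)) x
  · obtain ⟨G', hG, hG'⟩ := hasFDerivAt_projMap A (hA.pos (h x)).ne'
    have key : ∀ w, mvfderiv (𝓡 n) (fun y => (F (h y) : Euc M)) x w =
        G' (mvfderiv (𝓡 n) (fun y => (h y : Euc N)) x w) := fun w => by
      simp only [hA.coe_eq_projMap]
      exact mvfderiv_fderiv_comp (g := fun y => (h y : Euc N)) hG hd w
    rw [pullbackCan, pullbackCan, key, key, hG', hG', ← hA.coe_eq_projMap]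
    have hu := inner_mvfderiv_eq_zero h hd u
    have hv := inner_mvfderiv_eq_zero h hd v
    set a := mvfderiv (𝓡 n) (fun y => (h y : Euc N)) x u
    set b := mvfderiv (𝓡 n) (fun y => (h y : Euc N)) x v
    have e1 := hA.bilin (a, 0) (b, 0)
    have e2 := hA.bilin (h x, 1) (a, 0)
    have e3 := hA.bilin (h x, 1) (b, 0)
    have hs := (hA.pos (h x)).ne'
    rw [hA.map (h x)] at e2 e3
    simp only [Prod.smul_fst, Prod.smul_snd, smul_eq_mul, inner_smul_left, hu, hv,
      conj_trivial, mul_zero, sub_zero, mul_one] at e1 e2 e3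
    have e2' : inner ℝ (F (h x) : Euc M) (A (a, 0)).1 = (A (a, 0)).2 := by
      apply mul_left_cancel₀ hs; linarith
    have e3' : inner ℝ (F (h x) : Euc M) (A (b, 0)).1 = (A (b, 0)).2 := by
      apply mul_left_cancel₀ hs; linarith
    have hF : inner ℝ (F (h x) : Euc M) (F (h x) : Euc M) = 1 := by
      rw [real_inner_self_eq_norm_sq]; simp
    simp only [inner_smul_left, inner_smul_right, inner_sub_left, inner_sub_right, conj_trivial,
      e3', hF, real_inner_comm (F (h x) : Euc M) (A (a, 0)).1, e2', mul_one]
    rw [← e1]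
    ring
  · rw [pullbackCan_of_not_mdifferentiableAt hd, pullbackCan_of_not_mdifferentiableAt
      ((hA.mdifferentiableAt_comp_iff h x).not.2 hd), mul_zero]

lemma volumeDensity_comp (hA : IsLorentzLift A F) {n : ℕ} (h : Sph n → Sph N) (x : Sph n) :
    volumeDensity (fun y => F (h y)) x = (A (h x, 1)).2⁻¹ ^ n * volumeDensity h x :=
  volumeDensity_of_pullbackCan_eq (inv_nonneg.2 (hA.pos (h x)).le)
    fun u v => hA.pullbackCan_comp h x u v

end IsLorentzLift

/-- The map of spheres given by a linear isometry. -/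
def sphMap {N M : ℕ} (L : Euc N →ₗᵢ[ℝ] Euc M) (x : Sph N) : Sph M := ⟨L x, by simp⟩

/-- The Lorentzian lift of a linear isometry `L` is `L × id`. -/
lemma isLorentzLift_sphMap {N M : ℕ} (L : Euc N →ₗᵢ[ℝ] Euc M) :
    IsLorentzLift (L.toLinearMap.prodMap (LinearMap.id : ℝ →ₗ[ℝ] ℝ)) (sphMap L) where
  form v := by simp [lorentzForm]
  pos x := by simp
  map x := by simp [sphMap]

lemma contMDiff_sphMap {N M : ℕ} (L : Euc N →ₗᵢ[ℝ] Euc M) :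
    ContMDiff (𝓡 N) (𝓡 M) ∞ (sphMap L) := by
  have := Fact.mk (@finrank_euclideanSpace_fin ℝ _ (N + 1))
  have := Fact.mk (@finrank_euclideanSpace_fin ℝ _ (M + 1))
  exact ContMDiff.codRestrict_sphere (f := fun x : Sph N => L (x : Euc N))
    (L.contDiff.contMDiff.comp contMDiff_coe_sphere) _

lemma pullbackCan_sphMap_comp {n N M : ℕ} (L : Euc N →ₗᵢ[ℝ] Euc M) (h : Sph n → Sph N)
    (x : Sph n) (u v : TangentSpace (𝓡 n) x) :
    pullbackCan (fun y => sphMap L (h y)) x u v = pullbackCan h x u v := by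
  simpa using (isLorentzLift_sphMap L).pullbackCan_comp h x u v

lemma IsConformalImmersionOn.sphMap_comp {n N M : ℕ} (L : Euc N →ₗᵢ[ℝ] Euc M)
    {h : Sph n → Sph N} {U : Set (Sph n)} (hU : IsConformalImmersionOn h U) :
    IsConformalImmersionOn (fun y => sphMap L (h y)) U where
  smooth := (contMDiff_sphMap L).comp_contMDiffOn hU.smooth
  conformal x hx := by
    obtain ⟨c, hc, h1⟩ := hU.conformal x hx
    exact ⟨c, hc, fun u v => by rw [pullbackCan_sphMap_comp, h1]⟩

lemma isConformalImmersionOn_sphMap {n N : ℕ} (L : Euc n →ₗᵢ[ℝ] Euc N) (U : Set (Sph n)) :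
    IsConformalImmersionOn (sphMap L) U :=
  IsConformalImmersionOn.sphMap_comp L (h := id)
    ⟨contMDiffOn_id, fun _ _ => ⟨1, one_pos, fun _ _ => (one_mul _).symm⟩⟩

/-- The density of the identity is `1`; the upper bound holds without checking that the Gram
determinant of the round metric is nonzero. -/
lemma volumeDensity_id_le_one {n : ℕ} (x : Sph n) : volumeDensity (id : Sph n → Sph n) x ≤ 1 :=
  Real.sqrt_le_one.2 (div_self_le_one _)

lemma volumeDensity_congr {n N : ℕ} {f g : Sph n → Sph N} {x : Sph n} (h : f =ᶠ[𝓝 x] g) :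
    volumeDensity f x = volumeDensity g x := by
  have h1 : mfderiv (𝓡 n) 𝓘(ℝ, Euc N) (fun y => (f y : Euc N)) x =
      mfderiv (𝓡 n) 𝓘(ℝ, Euc N) (fun y => (g y : Euc N)) x :=
    Filter.EventuallyEq.mfderiv_eq (h.mono fun y hy => congrArg Subtype.val hy)
  have h2 : ∀ u v : TangentSpace (𝓡 n) x, pullbackCan f x u v = pullbackCan g x u v := by
    intro u v
    have h3 : ∀ w, mvfderiv (𝓡 n) (fun y => (f y : Euc N)) x w =
        mvfderiv (𝓡 n) (fun y => (g y : Euc N)) x w := fun w => congrArg (fun L => L w) h1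
    rw [pullbackCan, pullbackCan, h3, h3]
  simpa using volumeDensity_of_pullbackCan_eq (a := 1) (n := n) zero_le_one
    (by simpa using h2)

lemma volumeDensity_sphMap_le_one {n N : ℕ} (L : Euc n →ₗᵢ[ℝ] Euc N) (x : Sph n) :
    volumeDensity (sphMap L) x ≤ 1 := by
  have h := (isLorentzLift_sphMap L).volumeDensity_comp (id : Sph n → Sph n) x
  simp only [id_eq] at h
  rw [h]
  simpa using volumeDensity_id_le_one x

/-! ### Möbius transformations and the existence of the limit -/

/-- The reflection of the Lorentzian space `ℝᴺ⁺¹ × ℝ` in the hyperplane orthogonal to `w`, for `w`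
with `lorentzForm w ≠ 0`. -/
def lorentzReflection {N : ℕ} (w : Euc N × ℝ) : Euc N × ℝ →ₗ[ℝ] Euc N × ℝ :=
  LinearMap.id - (2 / lorentzForm w) • LinearMap.smulRight
    ((innerₛₗ ℝ w.1) ∘ₗ LinearMap.fst ℝ _ _ - w.2 • LinearMap.snd ℝ _ _) w

lemma lorentzReflection_apply {N : ℕ} (w v : Euc N × ℝ) :
    lorentzReflection w v = v - (2 / lorentzForm w * (inner ℝ w.1 v.1 - w.2 * v.2)) • w := by
  simp [lorentzReflection, smul_smul]

lemma lorentzForm_lorentzReflection {N : ℕ} {w : Euc N × ℝ} (hw : lorentzForm w ≠ 0)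
    (v : Euc N × ℝ) : lorentzForm (lorentzReflection w v) = lorentzForm v := by
  rw [lorentzReflection_apply]
  obtain ⟨a, r⟩ := w
  obtain ⟨y, t⟩ := v
  have h : ∀ k : ℝ, lorentzForm ((y, t) - k • (a, r)) =
      lorentzForm (y, t) - 2 * k * (inner ℝ a y - r * t) + k ^ 2 * lorentzForm (a, r) := fun k => by
    simp only [lorentzForm, Prod.fst_sub, Prod.snd_sub, Prod.smul_fst, Prod.smul_snd,
      norm_sub_sq_real, norm_smul, inner_smul_right, real_inner_comm a y, mul_pow,
      Real.norm_eq_abs, sq_abs, smul_eq_mul]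
    ring
  rw [h]
  field_simp
  ring

lemma isLorentzLift_reflection {N : ℕ} {σ : Sph N → Sph N} {a : Euc N} (ha : a ≠ 0)
    (hσ : ∀ x : Sph N, (σ x : Euc N) = (ℝ ∙ a)ᗮ.reflection (x : Euc N)) :
    IsLorentzLift (lorentzReflection (a, 0)) σ := by
  have hw : lorentzForm (a, (0 : ℝ)) = ‖a‖ ^ 2 := by simp [lorentzForm]
  have hs : ∀ x : Sph N, lorentzReflection (a, 0) (x, 1) = ((σ x : Euc N), (1 : ℝ)) := fun x => by
    rw [lorentzReflection_apply, hσ, hw, Submodule.reflection_orthogonal_apply,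
      Submodule.reflection_singleton_apply]
    ext1
    · simp only [zero_mul, sub_zero, Prod.fst_sub, Prod.smul_fst, RCLike.ofReal_real_eq_id, id_eq,
        neg_sub, two_smul, ← add_smul]
      congr 2
      ring
    · simp
  refine ⟨lorentzForm_lorentzReflection (by rw [hw]; positivity), fun x => ?_, fun x => ?_⟩ <;>
  simp [hs]

/-- The dilatation coefficient of the inversion with centre `a`. -/
lemma lorentzReflection_inversion_snd {N : ℕ} (a x : Euc N) :
    (lorentzReflection (a, 1) (x, 1)).2 = 1 - 2 / (‖a‖ ^ 2 - 1) * (inner ℝ a x - 1) := by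
  simp [lorentzReflection_apply, lorentzForm]

lemma lorentzReflection_inversion {N : ℕ} {a : Euc N} (ha : 1 < ‖a‖) {x : Euc N}
    (hx : ‖x‖ = 1) :
    0 < (lorentzReflection (a, 1) (x, 1)).2 ∧
    lorentzReflection (a, 1) (x, 1) = (lorentzReflection (a, 1) (x, 1)).2 •
      (EuclideanGeometry.inversion a √(‖a‖ ^ 2 - 1) x, (1 : ℝ)) := by
  have hq : 0 < ‖a‖ ^ 2 - 1 := by nlinarith
  have hd : dist x a ^ 2 = ‖a‖ ^ 2 + 1 - 2 * inner ℝ a x := by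
    rw [dist_eq_norm, norm_sub_sq_real, hx, real_inner_comm]; ring
  have hd0 : 0 < dist x a := by
    rw [dist_pos]; rintro rfl; linarith
  have hs : (lorentzReflection (a, 1) (x, 1)).2 = dist x a ^ 2 / (‖a‖ ^ 2 - 1) := by
    rw [lorentzReflection_inversion_snd, hd]
    field_simp
    ring
  refine ⟨by rw [hs]; positivity, ?_⟩
  rw [hs]
  ext1
  · rw [lorentzReflection_apply, Prod.smul_fst, EuclideanGeometry.inversion, div_pow,
      Real.sq_sqrt hq.le, vsub_eq_sub, vadd_eq_add, smul_add, smul_smul, div_mul_div_cancel₀ hq.ne',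
      div_self (by positivity), one_smul]
    simp only [lorentzForm, Prod.fst_sub, Prod.smul_fst]
    have hk : 2 / (‖a‖ ^ 2 - 1 ^ 2) * (inner ℝ a x - 1 * 1) =
        1 - dist x a ^ 2 / (‖a‖ ^ 2 - 1) := by
      rw [hd, one_pow]
      field_simp
      ring
    rw [hk]
    module
  · rw [hs]; simp

lemma isLorentzLift_inversion {N : ℕ} {σ : Sph N → Sph N} {a : Euc N} (ha : 1 < ‖a‖)
    (hσ : ∀ x : Sph N,
      (σ x : Euc N) = EuclideanGeometry.inversion a √(‖a‖ ^ 2 - 1) (x : Euc N)) :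
    IsLorentzLift (lorentzReflection (a, 1)) σ where
  form := lorentzForm_lorentzReflection (by simp only [lorentzForm]; nlinarith)
  pos x := (lorentzReflection_inversion ha (by simp)).1
  map x := by
    rw [hσ]
    exact (lorentzReflection_inversion ha (by simp)).2

/-- Every Möbius transformation is induced by a Lorentzian linear map. -/
lemma exists_isLorentzLift {N : ℕ} {μ : Equiv.Perm (Sph N)} (hμ : μ ∈ Moeb N) :
    ∃ A, IsLorentzLift A μ := by
  induction hμ using Subgroup.closure_induction with
  | mem σ hσ =>
    rcases hσ with ⟨a, ha, h⟩ | ⟨a, ha, h⟩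
    · exact ⟨_, isLorentzLift_reflection ha h⟩
    · exact ⟨_, isLorentzLift_inversion ha h⟩
  | one => exact ⟨LinearMap.id, fun _ => rfl, fun _ => by simp, fun _ => by simp⟩
  | mul μ ν _ _ hμ hν =>
    obtain ⟨A, hA⟩ := hμ
    obtain ⟨B, hB⟩ := hν
    exact ⟨_, hA.comp hB⟩
  | inv μ _ hμ =>
    obtain ⟨A, hA⟩ := hμ
    let e := LinearEquiv.ofInjectiveEndo A hA.injective
    have he : ∀ v, A (e.symm v) = v := fun v => e.apply_symm_apply v
    have key : ∀ x : Sph N, e.symm ((x : Euc N), (1 : ℝ)) =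
        (A (μ⁻¹ x, 1)).2⁻¹ • ((μ⁻¹ x : Euc N), (1 : ℝ)) := fun x => by
      apply hA.injective
      have h1 := hA.map (μ⁻¹ x)
      rw [← Equiv.Perm.mul_apply, mul_inv_cancel, Equiv.Perm.one_apply] at h1
      rw [he, map_smul, eq_inv_smul_iff₀ (hA.pos _).ne', ← h1]
    refine ⟨e.symm, fun v => ?_, fun x => ?_, fun x => ?_⟩
    · rw [← hA.form]
      exact congrArg lorentzForm (he v)
    · simpa [key] using hA.pos (μ⁻¹ x)
    · simp [key]

/-- Any affine function that can be a dilatation coefficient on `𝕊ᴺ` dominates the dilatation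
coefficient `√(1 + ‖α‖²) + ⟨α, x⟩` of some Möbius transformation of `𝕊ᴺ` itself. -/
lemma exists_moeb_le {N : ℕ} (c : ℝ) (α : Euc N) (hc : 0 < c) (hα : 1 + ‖α‖ ^ 2 ≤ c ^ 2) :
    ∃ μ ∈ Moeb N, ∃ A, IsLorentzLift A μ ∧
      ∀ x : Sph N, (A (x, 1)).2 ≤ c + inner ℝ α (x : Euc N) := by
  by_cases h0 : α = 0
  · refine ⟨1, one_mem _, LinearMap.id, ⟨fun _ => rfl, fun _ => by simp, fun _ => by simp⟩,
      fun x => ?_⟩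
    simp only [h0, norm_zero, LinearMap.id_apply, inner_zero_left] at hα ⊢
    nlinarith
  have hα0 : 0 < ‖α‖ := norm_pos_iff.2 h0
  set b : ℝ := √(1 + ‖α‖ ^ 2) with hb
  have hb2 : b ^ 2 = 1 + ‖α‖ ^ 2 := Real.sq_sqrt (by positivity)
  have hbc : b ≤ c := Real.sqrt_le_iff.2 ⟨hc.le, hα⟩
  have hb0 : 0 ≤ b := Real.sqrt_nonneg _
  have hb1 : 1 < b := by nlinarith
  -- The centre is chosen so that the dilatation coefficient is `b + ⟨α, x⟩`.
  set a : Euc N := -((b - 1)⁻¹ • α) with ha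
  have hb1' : 0 < b - 1 := by linarith
  have hna : ‖a‖ ^ 2 = (b + 1) / (b - 1) := by
    have : ‖α‖ ^ 2 = (b - 1) * (b + 1) := by linarith
    rw [ha, norm_neg, norm_smul, mul_pow, this, Real.norm_eq_abs, sq_abs]
    field_simp
  have ha1 : 1 < ‖a‖ := by
    have : 1 < ‖a‖ ^ 2 := by rw [hna, one_lt_div hb1']; linarith
    exact (one_lt_sq_iff₀ (norm_nonneg _)).1 this
  have hq : 0 < ‖a‖ ^ 2 - 1 := by nlinarith
  have hmem : ∀ x : Sph N,
      EuclideanGeometry.inversion a √(‖a‖ ^ 2 - 1) (x : Euc N) ∈ Metric.sphere (0 : Euc N) 1 := by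
    intro x
    obtain ⟨h1, h2⟩ := lorentzReflection_inversion ha1 (x := x) (by simp)
    have h3 := lorentzForm_lorentzReflection (w := (a, (1 : ℝ)))
      (by simp only [lorentzForm]; nlinarith) (x, 1)
    rw [h2] at h3
    simp only [lorentzForm, Prod.smul_fst, Prod.smul_snd, norm_smul, mul_pow, Real.norm_eq_abs,
      sq_abs, norm_eq_of_mem_sphere, smul_eq_mul, mul_one, one_pow, sub_self] at h3
    rw [mem_sphere_zero_iff_norm]
    have h4 : ‖EuclideanGeometry.inversion a √(‖a‖ ^ 2 - 1) (x : Euc N)‖ ^ 2 = 1 := by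
      have := pow_pos h1 2
      apply mul_left_cancel₀ this.ne'
      linarith
    exact (pow_eq_one_iff_of_nonneg (norm_nonneg _) two_ne_zero).1 h4
  let f : Sph N → Sph N := fun x => ⟨_, hmem x⟩
  have hf : Function.Involutive f := fun x => Subtype.ext <|
    EuclideanGeometry.inversion_involutive a (Real.sqrt_pos.2 hq).ne' _
  refine ⟨hf.toPerm, Subgroup.subset_closure (Or.inr ⟨a, ha1, fun x => rfl⟩), _,
    isLorentzLift_inversion ha1 fun x => rfl, fun x => ?_⟩
  rw [lorentzReflection_inversion_snd, hna, ha, inner_neg_left, inner_smul_left]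
  have : 1 - 2 / ((b + 1) / (b - 1) - 1) * (-((b - 1)⁻¹ * inner ℝ α (x : Euc N)) - 1) =
      b + inner ℝ α (x : Euc N) := by
    field_simp
    ring
  simp only [conj_trivial, this]
  linarith

/-- Composing with the inclusion of a great sphere does not increase the volume: the restriction of
a Möbius transformation to the great sphere has pointwise at most the conformal factor of a Möbius
transformation of that sphere. -/
lemma mapPCVolume_sphMap_comp_le {n N M : ℕ} (Γ : Subgroup (Orth n)) (φ : Orbifold Γ → Sph N)
    (L : Euc N →ₗᵢ[ℝ] Euc M) :
    mapPCVolume Γ (fun p => sphMap L (φ p)) ≤ mapPCVolume Γ φ := by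
  refine iSup₂_le fun μ hμ => ?_
  obtain ⟨A, hA⟩ := exists_isLorentzLift hμ
  have hAL := hA.comp (isLorentzLift_sphMap L)
  obtain ⟨c, α, hc, hα, hs⟩ := hAL.exists_affine
  obtain ⟨ν, hν, B, hB, hBs⟩ := exists_moeb_le c α hc hα
  refine le_trans ?_ (le_iSup₂ (f := fun μ (_ : μ ∈ Moeb N) =>
    pullbackVolume Γ (fun p => μ (φ p))) ν hν)
  refine ENNReal.div_le_div_right (lintegral_mono fun x => ENNReal.ofReal_le_ofReal ?_) _
  have h1 := hAL.volumeDensity_comp (fun y => φ (proj Γ y)) x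
  have h2 := hB.volumeDensity_comp (fun y => φ (proj Γ y)) x
  simp only [Function.comp_apply] at h1
  rw [h1, h2]
  refine mul_le_mul_of_nonneg_right ?_ (Real.sqrt_nonneg _)
  refine pow_le_pow_left₀ (inv_nonneg.2 (hAL.pos _).le) (inv_anti₀ (hB.pos _) ?_) n
  rw [hs, mul_one]
  exact hBs _

lemma continuous_sphMap {N M : ℕ} (L : Euc N →ₗᵢ[ℝ] Euc M) : Continuous (sphMap L) :=
  (contMDiff_sphMap L).continuous

lemma IsPC.sphMap_comp {n N M : ℕ} {Γ : Subgroup (Orth n)} {φ : Orbifold Γ → Sph N}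
    (hφ : IsPC Γ φ) (L : Euc N →ₗᵢ[ℝ] Euc M) : IsPC Γ (fun p => sphMap L (φ p)) where
  continuous := (continuous_sphMap L).comp hφ.continuous
  piecewise := by
    obtain ⟨k, P, hP, hcov, h⟩ := hφ.piecewise
    refine ⟨k, P, hP, hcov, fun i => ?_⟩
    obtain ⟨U, f, hU, hPU, hf, hφf⟩ := h i
    exact ⟨U, _, hU, hPU, hf.sphMap_comp L, fun x hx => by rw [hφf x hx]⟩

/-- The inclusion `y ↦ (0, y)` of `ℝᴺ⁺¹` in `ℝᴺ⁺²`. -/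
def consZero (N : ℕ) : Euc N →ₗᵢ[ℝ] Euc (N + 1) where
  toFun y := WithLp.toLp 2 (Fin.cons 0 y)
  map_add' x y := by
    ext i; refine Fin.cases ?_ (fun j => ?_) i <;> simp
  map_smul' r x := by
    ext i; refine Fin.cases ?_ (fun j => ?_) i <;> simp
  norm_map' y := by
    simp only [EuclideanSpace.norm_eq]
    simp [Fin.sum_univ_succ (n := N + 1)]

lemma antitone_dimPCVolume {n : ℕ} (Γ : Subgroup (Orth n)) :
    Antitone fun N : ℕ => dimPCVolume N Γ := by
  refine antitone_nat_of_succ_le fun N => le_iInf₂ fun φ hφ => ?_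
  exact (iInf₂_le _ (hφ.sphMap_comp (consZero N))).trans
    (mapPCVolume_sphMap_comp_le Γ φ (consZero N))

lemma tendsto_dimPCVolume {n : ℕ} (Γ : Subgroup (Orth n)) :
    Filter.Tendsto (fun N : ℕ => dimPCVolume N Γ) Filter.atTop (𝓝 (⨅ N, dimPCVolume N Γ)) :=
  tendsto_atTop_iInf (antitone_dimPCVolume Γ)

lemma pcVolume_eq_iInf {n : ℕ} (Γ : Subgroup (Orth n)) :
    pcVolume Γ = ⨅ N, dimPCVolume N Γ :=
  (tendsto_dimPCVolume Γ).limUnder_eq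

/-! ### The sorting map -/

section Sorting

variable {n k N : ℕ} {Γ : Subgroup (Orth n)} (e : Fin k ≃ Γ)
  (r : Fin (N + 1) ≃ Fin (n + 1) × Fin k)

/-- The `i`-th coordinates of the points of the orbit `Γ x`, for an enumeration `e` of `Γ`. -/
def orbitCoord (x : Euc n) (i : Fin (n + 1)) (j : Fin k) : ℝ := (e j : Orth n) x i

/-- The normal vector of the wall on which two of the `i`-th coordinates of the orbit agree. It
vanishes when these coordinates agree everywhere. -/
def wall (t : Fin (n + 1) × Fin k × Fin k) : Euc n :=
  (e t.2.1 : Orth n).symm (EuclideanSpace.single t.1 1) -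
    (e t.2.2 : Orth n).symm (EuclideanSpace.single t.1 1)

lemma inner_wall (i : Fin (n + 1)) (j j' : Fin k) (x : Euc n) :
    inner ℝ (wall e (i, j, j')) x = orbitCoord e x i j - orbitCoord e x i j' := by
  have h : ∀ l, inner ℝ ((e l : Orth n).symm (EuclideanSpace.single i 1)) x =
      orbitCoord e x i l := fun l => by
    rw [← LinearIsometryEquiv.inner_map_map (e l : Orth n), LinearIsometryEquiv.apply_symm_apply,
      EuclideanSpace.inner_single_left]
    simp [orbitCoord]
  rw [wall, inner_sub_left, h, h]

/-- For permutations `σ i` of the orbit, the linear isometry listing the `i`-th coordinates of the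
orbit in the order `σ i`, for all `i`, normalised by `k^{-1/2}`. -/
def chamberMap (σ : Fin (n + 1) → Equiv.Perm (Fin k)) : Euc n →ₗᵢ[ℝ] Euc N where
  toFun x := WithLp.toLp 2 fun l => (√k)⁻¹ * orbitCoord e x (r l).1 (σ (r l).1 (r l).2)
  map_add' x y := by ext l; simp [orbitCoord, mul_add]
  map_smul' c x := by ext l; simp [orbitCoord, mul_left_comm]
  norm_map' x := by
    have hk : 0 < (k : ℝ) := by
      exact_mod_cast Fin.pos (r 0).2
    have h1 : ∑ l, orbitCoord e x (r l).1 (σ (r l).1 (r l).2) ^ 2 = k * ‖x‖ ^ 2 := by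
      rw [r.sum_comp (fun p => orbitCoord e x p.1 (σ p.1 p.2) ^ 2), Fintype.sum_prod_type]
      have h0 : ∀ i, ∑ j, orbitCoord e x i (σ i j) ^ 2 = ∑ j, orbitCoord e x i j ^ 2 := fun i =>
        Equiv.sum_comp (σ i) fun j => orbitCoord e x i j ^ 2
      simp only [h0]
      rw [Finset.sum_comm]
      have h2 : ∀ j, ∑ i, orbitCoord e x i j ^ 2 = ‖x‖ ^ 2 := fun j => by
        rw [← LinearIsometryEquiv.norm_map (e j : Orth n) x, EuclideanSpace.real_norm_sq_eq]
        rfl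
      simp [h2]
    have h3 : ∀ y : Euc N, ‖y‖ ^ 2 = ‖x‖ ^ 2 → ‖y‖ = ‖x‖ := fun y h =>
      (sq_eq_sq₀ (norm_nonneg _) (norm_nonneg _)).1 h
    apply h3
    rw [EuclideanSpace.real_norm_sq_eq]
    simp only [LinearMap.coe_mk, AddHom.coe_mk, mul_pow, ← Finset.mul_sum, h1, inv_pow,
      Real.sq_sqrt hk.le]
    field_simp

/-- The map listing the coordinates of the points of the orbit `Γ x` in increasing order. -/
def sortedMap (x : Sph n) : Sph N :=
  sphMap (chamberMap e r fun i => Tuple.sort (orbitCoord e x i)) x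

/-- The chamber where the orders `σ i` of the `i`-th coordinates of the orbit are increasing. -/
def chamber (σ : Fin (n + 1) → Equiv.Perm (Fin k)) : Set (Sph n) :=
  {x | ∀ i, Monotone (orbitCoord e x i ∘ σ i)}

lemma mem_chamber_sort (x : Sph n) :
    x ∈ chamber e fun i => Tuple.sort (orbitCoord e x i) :=
  fun i => Tuple.monotone_sort (orbitCoord e x i)

lemma sphMap_chamberMap_congr {σ τ : Fin (n + 1) → Equiv.Perm (Fin k)} {x y : Sph n}
    (h : ∀ i, orbitCoord e x i ∘ σ i = orbitCoord e y i ∘ τ i) :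
    sphMap (chamberMap e r σ) x = sphMap (chamberMap e r τ) y := by
  ext l
  exact congrArg ((√k)⁻¹ * ·) (congrFun (h (r l).1) (r l).2)

lemma sortedMap_eq {σ : Fin (n + 1) → Equiv.Perm (Fin k)} {x : Sph n} (hx : x ∈ chamber e σ) :
    sortedMap e r x = sphMap (chamberMap e r σ) x :=
  sphMap_chamberMap_congr e r fun i => Tuple.unique_monotone (Tuple.monotone_sort _) (hx i)

lemma sortedMap_smul (γ : Γ) (x : Sph n) : sortedMap e r (γ • x) = sortedMap e r x := by
  let τ : Equiv.Perm (Fin k) := (e.trans (Equiv.mulRight γ)).trans e.symm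
  have hτ : ∀ i, orbitCoord e (γ • x : Sph n) i = orbitCoord e x i ∘ τ := fun i => by
    funext j
    have : e (τ j) = e j * γ := by simp [τ]
    rw [Function.comp_apply, orbitCoord, orbitCoord, this]
    rfl
  refine sphMap_chamberMap_congr e r fun i => ?_
  rw [hτ]
  exact Tuple.comp_perm_comp_sort_eq_comp_sort

lemma continuous_orbitCoord (i : Fin (n + 1)) (j : Fin k) :
    Continuous fun x : Sph n => orbitCoord e x i j := by
  unfold orbitCoord
  fun_prop

lemma isClosed_chamber (σ : Fin (n + 1) → Equiv.Perm (Fin k)) : IsClosed (chamber e σ) := by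
  have : chamber e σ = ⋂ (i) (j) (j') (_ : j ≤ j'),
      {x : Sph n | orbitCoord e x i (σ i j) ≤ orbitCoord e x i (σ i j')} := by
    ext x
    simp [chamber, Monotone]
  rw [this]
  exact isClosed_iInter fun i => isClosed_iInter fun j => isClosed_iInter fun j' =>
    isClosed_iInter fun _ => isClosed_le (continuous_orbitCoord e _ _) (continuous_orbitCoord e _ _)

lemma iUnion_chamber : (⋃ σ, chamber e σ) = Set.univ :=
  Set.eq_univ_of_forall fun x => Set.mem_iUnion.2 ⟨_, mem_chamber_sort e x⟩

lemma continuous_sortedMap : Continuous (sortedMap e r) :=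
  (locallyFinite_of_finite _).continuous (iUnion_chamber e) (isClosed_chamber e) fun σ =>
    (continuous_sphMap (chamberMap e r σ)).continuousOn.congr fun _ hx => sortedMap_eq e r hx

/-- Away from the walls, the order of the coordinates is locally constant, up to the coordinates
that agree everywhere. -/
lemma chamber_mem_nhds {σ : Fin (n + 1) → Equiv.Perm (Fin k)} {x : Sph n} (hx : x ∈ chamber e σ)
    (hreg : ∀ t, wall e t ≠ 0 → inner ℝ (wall e t) (x : Euc n) ≠ 0) : chamber e σ ∈ 𝓝 x := by
  have h : ∀ t : Fin (n + 1) × Fin k × Fin k, ∀ᶠ y : Sph n in 𝓝 x,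
      inner ℝ (wall e t) (x : Euc n) ≤ 0 → inner ℝ (wall e t) (y : Euc n) ≤ 0 := fun t => by
    by_cases h0 : wall e t = 0
    · simp [h0]
    by_cases hle : inner ℝ (wall e t) (x : Euc n) ≤ 0
    · have hc : Continuous fun y : Sph n => inner ℝ (wall e t) (y : Euc n) := by fun_prop
      filter_upwards [hc.continuousAt.eventually_lt_const (lt_of_le_of_ne hle (hreg t h0))]
        with y hy _ using hy.le
    · exact .of_forall fun _ h => absurd h hle
  filter_upwards [Filter.eventually_all.2 h] with y hy i j j' hjj'
  have h1 := hy (i, σ i j, σ i j')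
  rw [inner_wall, inner_wall] at h1
  exact sub_nonpos.1 (h1 (sub_nonpos.2 (hx i hjj')))

end Sorting

lemma isSmoothHypersurface_empty {n : ℕ} : IsSmoothHypersurface (∅ : Set (Sph n)) :=
  ⟨∅, fun _ => 0, isOpen_empty, contMDiffOn_const, by simp, by simp⟩

lemma isSmoothHypersurface_great_sphere {n : ℕ} {w : Euc n} (hw : w ≠ 0) :
    IsSmoothHypersurface {x : Sph n | inner ℝ w (x : Euc n) = 0} := by
  have := Fact.mk (@finrank_euclideanSpace_fin ℝ _ (n + 1))
  have hcoe : ContMDiff (𝓡 n) 𝓘(ℝ, Euc n) ∞ ((↑) : Sph n → Euc n) := contMDiff_coe_sphere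
  refine ⟨Set.univ, fun x => innerSL ℝ w (x : Euc n), isOpen_univ,
    ((innerSL ℝ w).contDiff.contMDiff.comp hcoe).contMDiffOn, by simp, ?_⟩
  intro x hx h0
  -- The normal vector `w` is itself tangent to the sphere at the points orthogonal to it.
  have hr : w ∈ (mvfderiv (𝓡 n) ((↑) : Sph n → Euc n) x).range := by
    have h1 := range_mvfderiv_subtypeVal (n := n) x
    erw [h1]
    rw [Submodule.mem_orthogonal_singleton_iff_inner_left]
    exact hx
  obtain ⟨u, hu⟩ := hr
  have h1 := mvfderiv_fderiv_comp (innerSL ℝ w).hasFDerivAt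
    (hcoe.mdifferentiableAt (by simp) : MDifferentiableAt (𝓡 n) 𝓘(ℝ, Euc n) _ x) u
  rw [h0] at h1
  have h2 : mvfderiv (𝓡 n) ((↑) : Sph n → Euc n) x u = w := hu
  rw [h2] at h1
  simp only [_root_.zero_apply, innerSL_apply_apply] at h1
  exact hw (inner_self_eq_zero.1 h1.symm)

section Sorting

variable {n k N : ℕ} {Γ : Subgroup (Orth n)} (e : Fin k ≃ Γ)
  (r : Fin (N + 1) ≃ Fin (n + 1) × Fin k)

lemma isPiece_chamber (σ : Fin (n + 1) → Equiv.Perm (Fin k)) : IsPiece (chamber e σ) where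
  isClosed := isClosed_chamber e σ
  boundary := by
    classical
    let Z : Fin (n + 1) × Fin k × Fin k → Set (Sph n) := fun t =>
      if wall e t = 0 then ∅ else {x : Sph n | inner ℝ (wall e t) (x : Euc n) = 0}
    let E := Fintype.equivFin (Fin (n + 1) × Fin k × Fin k)
    refine ⟨_, fun j => Z (E.symm j), fun j => ?_, fun x hx => ?_⟩
    · simp only [Z]
      split_ifs with h
      · exact isSmoothHypersurface_empty
      · exact isSmoothHypersurface_great_sphere h
    · by_contra hcon
      rw [(isClosed_chamber e σ).frontier_eq] at hx
      refine hx.2 (mem_interior_iff_mem_nhds.2 (chamber_mem_nhds e hx.1 fun t ht h0 => hcon ?_))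
      exact Set.mem_iUnion.2 ⟨E t, by simpa [Z, ht] using h0⟩

/-- The map that the sorting map induces on the orbifold. -/
def orbifoldSortedMap : Orbifold Γ → Sph N :=
  Quotient.lift (sortedMap e r) <| by
    rintro x y ⟨γ, rfl⟩
    exact sortedMap_smul e r γ y

lemma isPC_orbifoldSortedMap : IsPC Γ (orbifoldSortedMap e r) where
  continuous := (continuous_sortedMap e r).quotient_lift _
  piecewise := by
    let E := Fintype.equivFin (Fin (n + 1) → Equiv.Perm (Fin k))
    refine ⟨_, fun j => chamber e (E.symm j), fun j => isPiece_chamber e _, ?_, fun j =>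
      ⟨Set.univ, _, isOpen_univ, Set.subset_univ _,
        isConformalImmersionOn_sphMap (chamberMap e r (E.symm j)) _, fun x hx =>
        sortedMap_eq e r hx.1⟩⟩
    rw [← iUnion_chamber e]
    exact E.symm.surjective.iUnion_comp (chamber e)

/-- Away from the walls, the sorting map is a local isometry. -/
lemma volumeDensity_sortedMap_le_one {x : Sph n}
    (hreg : ∀ t, wall e t ≠ 0 → inner ℝ (wall e t) (x : Euc n) ≠ 0) :
    volumeDensity (sortedMap e r) x ≤ 1 := by
  rw [volumeDensity_congr (g := sphMap (chamberMap e r fun i => Tuple.sort (orbitCoord e x i)))]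
  · exact volumeDensity_sphMap_le_one _ x
  · filter_upwards [chamber_mem_nhds e (mem_chamber_sort e x) hreg] with y hy
    exact sortedMap_eq e r hy

end Sorting

/-! ### The number of chambers -/

section Counting

variable {n : ℕ} {ι : Type*} [Fintype ι]

open Classical in
/-- The sign pattern of `x` with respect to an arrangement of hyperplanes with normals `w`. -/
def signPattern (w : ι → Euc n) (x : Euc n) : Finset ι := {t | 0 < inner ℝ (w t) x}

lemma mem_signPattern {w : ι → Euc n} {x : Euc n} {t : ι} :
    t ∈ signPattern w x ↔ 0 < inner ℝ (w t) x := by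
  simp [signPattern]

variable [DecidableEq ι]

open Classical in
/-- The sign patterns of an arrangement that occur on an open half-space. -/
def halfSpacePatterns (w : ι → Euc n) (w₀ : Euc n) : Finset (Finset ι) :=
  {S | ∃ x, 0 < inner ℝ w₀ x ∧ signPattern w x = S}

/-- Restricting to a half-space lowers the Vapnik–Chervonenkis dimension of the sign patterns from
`n + 1` to `n`: if the pattern were arbitrary on `n + 1` of the hyperplanes, then these together
with the boundary of the half-space would have linearly independent normals. -/
lemma vcDim_halfSpacePatterns_le (w : ι → Euc n) (w₀ : Euc n) :
    (halfSpacePatterns w w₀).vcDim ≤ n := by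
  classical
  refine Finset.sup_le fun T hT => ?_
  rw [Finset.mem_shatterer] at hT
  by_contra! hcard
  let v : Option T → Euc n := fun o => o.elim w₀ fun t => w t
  have hdep : ¬ LinearIndependent ℝ v := fun hli => by
    have := hli.fintype_card_le_finrank
    simp only [Fintype.card_option, Fintype.card_coe, finrank_euclideanSpace,
      Fintype.card_fin] at this
    omega
  rw [Fintype.not_linearIndependent_iff] at hdep
  obtain ⟨g, hg, hne⟩ := hdep
  -- Up to a change of sign, the relation is positive on `w₀`, or else on some other normal.
  obtain ⟨g, hg, hpos⟩ : ∃ g : Option T → ℝ, ∑ o, g o • v o = 0 ∧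
      0 ≤ g none ∧ ∃ o, 0 < g o := by
    obtain ⟨o, ho⟩ := hne
    have hneg : ∑ o, (-g) o • v o = 0 := by simp [hg]
    rcases lt_trichotomy (g none) 0 with h | h | h
    · exact ⟨-g, hneg, by simpa using h.le, none, by simpa using h⟩
    · rcases lt_or_gt_of_ne ho with h' | h'
      · exact ⟨-g, hneg, by simp [h], o, by simpa using h'⟩
      · exact ⟨g, hg, h.ge, o, h'⟩
    · exact ⟨g, hg, h.le, none, h⟩
  obtain ⟨hnone, o, ho⟩ := hpos
  -- A point whose pattern is given by the signs of the coefficients contradicts the relation.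
  obtain ⟨S, hS, hTS⟩ := hT (t := T.filter fun t => ∃ h : t ∈ T, 0 < g (some ⟨t, h⟩))
    (Finset.filter_subset _ _)
  obtain ⟨x, hx0, rfl⟩ : ∃ x, 0 < inner ℝ w₀ x ∧ signPattern w x = S := by
    simpa [halfSpacePatterns] using hS
  have hsign : ∀ t : T, 0 < inner ℝ (w t) x ↔ 0 < g (some t) := fun t => by
    have h1 := Finset.ext_iff.1 hTS t
    simpa [mem_signPattern] using h1
  have hnonneg : ∀ o, 0 ≤ g o * inner ℝ (v o) x := fun o => by
    cases o with
    | none => exact mul_nonneg hnone hx0.le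
    | some t =>
      by_cases h : 0 < g (some t)
      · exact mul_nonneg h.le ((hsign t).2 h).le
      · exact mul_nonneg_of_nonpos_of_nonpos (not_lt.1 h) (not_lt.1 ((hsign t).not.2 h))
  have hsum : ∑ o, g o * inner ℝ (v o) x = 0 := by
    calc ∑ o, g o * inner ℝ (v o) x = inner ℝ (∑ o, g o • v o) x := by
          simp only [sum_inner, inner_smul_left, conj_trivial]
      _ = 0 := by rw [hg, inner_zero_left]
  have hzero := (Finset.sum_eq_zero_iff_of_nonneg fun o _ => hnonneg o).1 hsum o (Finset.mem_univ o)
  have hvo : 0 < inner ℝ (v o) x := by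
    cases o with
    | none => exact hx0
    | some t => exact (hsign t).2 ho
  exact (mul_pos ho hvo).ne' hzero

lemma card_halfSpacePatterns_le [Nonempty ι] (w : ι → Euc n) (w₀ : Euc n) :
    (halfSpacePatterns w w₀).card ≤ (n + 1) * Fintype.card ι ^ n := by
  calc _ ≤ (halfSpacePatterns w w₀).shatterer.card := Finset.card_le_card_shatterer _
    _ ≤ ∑ i ∈ Finset.Iic (halfSpacePatterns w w₀).vcDim, (Fintype.card ι).choose i :=
      Finset.card_shatterer_le_sum_vcDim
    _ ≤ ∑ i ∈ Finset.Iic n, (Fintype.card ι).choose i :=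
      Finset.sum_le_sum_of_subset (Finset.Iic_subset_Iic.2 (vcDim_halfSpacePatterns_le w w₀))
    _ ≤ ∑ i ∈ Finset.Iic n, Fintype.card ι ^ n := Finset.sum_le_sum fun i hi =>
      (Nat.choose_le_pow _ _).trans
        (Nat.pow_le_pow_right Fintype.card_pos (Finset.mem_Iic.1 hi))
    _ = _ := by simp

end Counting

/-! ### The volume of the sorting map -/

lemma ae_inner_ne_zero {n : ℕ} {w : Euc n} (hw : w ≠ 0) :
    ∀ᵐ x : Sph n ∂(volume : Measure (Euc n)).toSphere, inner ℝ w (x : Euc n) ≠ 0 := by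
  have hm : MeasurableSet {x : Sph n | inner ℝ w (x : Euc n) = 0} :=
    (isClosed_eq (by fun_prop) continuous_const).measurableSet
  have h : {x : Sph n | ¬ inner ℝ w (x : Euc n) ≠ 0} = {x : Sph n | inner ℝ w (x : Euc n) = 0} := by
    ext x; simp
  rw [ae_iff, h, Measure.toSphere_apply' _ hm]
  refine mul_eq_zero_of_right _ (measure_mono_null (t := ((ℝ ∙ w)ᗮ : Submodule ℝ (Euc n))) ?_ ?_)
  · rintro _ ⟨a, -, _, ⟨x, hx, rfl⟩, rfl⟩
    refine Submodule.mem_orthogonal_singleton_iff_inner_right.2 ?_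
    have hx' : inner ℝ w (x : Euc n) = 0 := hx
    simp [inner_smul_right, hx']
  · refine Measure.addHaar_submodule _ _ fun htop => hw ?_
    have : w ∈ (ℝ ∙ w)ᗮ := htop ▸ Submodule.mem_top
    exact inner_self_eq_zero.1 (Submodule.mem_orthogonal_singleton_iff_inner_right.1 this)

/-- The volume of the image of a Möbius transformation of a great sphere is bounded. -/
lemma IsLorentzLift.lintegral_le {n M : ℕ} {A : Euc n × ℝ →ₗ[ℝ] Euc M × ℝ} {F : Sph n → Sph M}
    (hA : IsLorentzLift A F) :
    ∫⁻ x : Sph n, ENNReal.ofReal ((A (x, 1)).2⁻¹ ^ n) ∂(volume : Measure (Euc n)).toSphere ≤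
      2 ^ n * (volume : Measure (Euc n)).toSphere Set.univ := by
  obtain ⟨c, α, hc, hα, hs⟩ := hA.exists_affine
  simpa only [hs, mul_one] using lintegral_sphere_conformal_factor_le c α hc hα

section Volume

variable {n k N : ℕ} {Γ : Subgroup (Orth n)} (e : Fin k ≃ Γ)
  (r : Fin (N + 1) ≃ Fin (n + 1) × Fin k)

lemma mem_chamber_of_signPattern_eq {σ : Fin (n + 1) → Equiv.Perm (Fin k)} {x y : Sph n}
    (hx : x ∈ chamber e σ) (h : signPattern (wall e) x = signPattern (wall e) y) :
    y ∈ chamber e σ := by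
  intro i j j' hjj'
  have h1 := (Finset.ext_iff.1 h (i, σ i j, σ i j')).not
  simp only [mem_signPattern, inner_wall, not_lt, sub_nonpos] at h1
  exact h1.1 (hx i hjj')

/-- On the points with a given sign pattern, the sorting map is a single linear isometry, although
the sorting permutations may differ in how they order coordinates that agree. -/
lemma exists_chamberMap_of_signPattern (S : Finset (Fin (n + 1) × Fin k × Fin k)) :
    ∃ σ : Fin (n + 1) → Equiv.Perm (Fin k), ∀ x : Sph n, signPattern (wall e) x = S →
      sortedMap e r x = sphMap (chamberMap e r σ) x := by
  by_cases h : ∃ x : Sph n, signPattern (wall e) x = S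
  · obtain ⟨x, rfl⟩ := h
    exact ⟨_, fun y hy =>
      sortedMap_eq e r (mem_chamber_of_signPattern_eq e (mem_chamber_sort e x) hy.symm)⟩
  · exact ⟨1, fun x hx => absurd ⟨x, hx⟩ h⟩

/-- Each sign pattern contributes at most the volume of one conformal image of `𝕊ⁿ`. -/
lemma lintegral_volumeDensity_sortedMap_le {μ : Equiv.Perm (Sph N)} (hμ : μ ∈ Moeb N) :
    ∫⁻ x : Sph n, ENNReal.ofReal (volumeDensity (fun y => μ (sortedMap e r y)) x)
        ∂(volume : Measure (Euc n)).toSphere ≤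
      (2 * ((n + 1) * ((n + 1) * (k * k)) ^ n) : ℕ) *
        (2 ^ n * (volume : Measure (Euc n)).toSphere Set.univ) := by
  classical
  obtain ⟨A, hA⟩ := exists_isLorentzLift hμ
  choose σ hσ using exists_chamberMap_of_signPattern e r
  let B := fun S => A ∘ₗ ((chamberMap e r (σ S)).toLinearMap.prodMap (LinearMap.id : ℝ →ₗ[ℝ] ℝ))
  have hB : ∀ S, IsLorentzLift (B S) (μ ∘ sphMap (chamberMap e r (σ S))) := fun S =>
    hA.comp (isLorentzLift_sphMap _)
  let w₀ : Euc n := EuclideanSpace.single 0 1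
  have hw₀ : w₀ ≠ 0 := by
    simp [w₀]
  let 𝒮 := halfSpacePatterns (wall e) w₀ ∪ halfSpacePatterns (wall e) (-w₀)
  have hcard : 𝒮.card ≤ 2 * ((n + 1) * ((n + 1) * (k * k)) ^ n) := by
    have : Nonempty (Fin (n + 1) × Fin k × Fin k) :=
      ⟨(0, (r 0).2, (r 0).2)⟩
    have h1 := card_halfSpacePatterns_le (wall e) w₀
    have h2 := card_halfSpacePatterns_le (wall e) (-w₀)
    simp only [Fintype.card_prod, Fintype.card_fin] at h1 h2
    refine (Finset.card_union_le _ _).trans ?_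
    omega
  have hae : ∀ᵐ x : Sph n ∂(volume : Measure (Euc n)).toSphere,
      ENNReal.ofReal (volumeDensity (fun y => μ (sortedMap e r y)) x) ≤
        ∑ S ∈ 𝒮, ENNReal.ofReal ((B S (x, 1)).2⁻¹ ^ n) := by
    have hreg : ∀ᵐ x : Sph n ∂(volume : Measure (Euc n)).toSphere,
        ∀ t, wall e t ≠ 0 → inner ℝ (wall e t) (x : Euc n) ≠ 0 := by
      refine ae_all_iff.2 fun t => ?_
      by_cases h : wall e t = 0
      · simp [h]
      · filter_upwards [ae_inner_ne_zero h] with x hx _ using hx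
    filter_upwards [hreg, ae_inner_ne_zero hw₀] with x hx hx0
    set S := signPattern (wall e) (x : Euc n) with hS
    have hmem : S ∈ 𝒮 := by
      simp only [𝒮, halfSpacePatterns, Finset.mem_union, Finset.mem_filter, Finset.mem_univ,
        true_and]
      rcases lt_or_gt_of_ne hx0 with h | h
      · exact Or.inr ⟨x, by rw [inner_neg_left]; linarith, rfl⟩
      · exact Or.inl ⟨x, h, rfl⟩
    refine le_trans (ENNReal.ofReal_le_ofReal ?_) (Finset.single_le_sum_of_canonicallyOrdered
      (f := fun S => ENNReal.ofReal ((B S (x, 1)).2⁻¹ ^ n)) hmem)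
    have hs : (B S (x, 1)).2 = (A (sortedMap e r x, 1)).2 := by
      rw [hσ S x rfl]; rfl
    have h0 : 0 ≤ (A (sortedMap e r x, 1)).2⁻¹ := inv_nonneg.2 (hA.pos _).le
    rw [hA.volumeDensity_comp (sortedMap e r) x, hs]
    exact mul_le_of_le_one_right (pow_nonneg h0 n) (volumeDensity_sortedMap_le_one e r hx)
  calc _ ≤ ∫⁻ x : Sph n, ∑ S ∈ 𝒮, ENNReal.ofReal ((B S (x, 1)).2⁻¹ ^ n)
        ∂(volume : Measure (Euc n)).toSphere := lintegral_mono_ae hae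
    _ = ∑ S ∈ 𝒮, ∫⁻ x : Sph n, ENNReal.ofReal ((B S (x, 1)).2⁻¹ ^ n)
        ∂(volume : Measure (Euc n)).toSphere := by
      refine lintegral_finsetSum _ fun S _ => ?_
      have : Continuous (B S) := (B S).continuous_of_finiteDimensional
      fun_prop
    _ ≤ ∑ S ∈ 𝒮, 2 ^ n * (volume : Measure (Euc n)).toSphere Set.univ :=
      Finset.sum_le_sum fun S _ => (hB S).lintegral_le
    _ = 𝒮.card * (2 ^ n * (volume : Measure (Euc n)).toSphere Set.univ) := by simp
    _ ≤ _ := by gcongr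

end Volume

/-- A dimensional constant bounding `V_PC(𝕊ⁿ/Γ) / |Γ|²ⁿ`. It has not been optimised: the factors are
a bound for the number of chambers, divided by `|Γ|²ⁿ`, and a bound for the volume of a conformal
image of `𝕊ⁿ`. -/
def volumeConstant (n : ℕ) : ℝ≥0∞ :=
  2 * (n + 1) ^ (n + 1) * (2 ^ n * (volume : Measure (Euc n)).toSphere Set.univ)

lemma volumeConstant_ne_top (n : ℕ) : volumeConstant n ≠ ⊤ := by
  unfold volumeConstant
  finiteness

lemma pcVolume_le {n : ℕ} (Γ : Subgroup (Orth n)) [Finite Γ] :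
    pcVolume Γ ≤ volumeConstant n * (Nat.card Γ : ℝ≥0∞) ^ (2 * n) := by
  have hk : 0 < Nat.card Γ := Nat.card_pos
  let e : Fin (Nat.card Γ) ≃ Γ := (Finite.equivFin Γ).symm
  have hN : (n + 1) * Nat.card Γ - 1 + 1 = (n + 1) * Nat.card Γ :=
    Nat.sub_add_cancel (Nat.mul_pos n.succ_pos hk)
  let r : Fin ((n + 1) * Nat.card Γ - 1 + 1) ≃ Fin (n + 1) × Fin (Nat.card Γ) :=
    (finCongr hN).trans finProdFinEquiv.symm
  rw [pcVolume_eq_iInf]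
  refine (iInf_le _ ((n + 1) * Nat.card Γ - 1)).trans
    ((iInf₂_le _ (isPC_orbifoldSortedMap e r)).trans (iSup₂_le fun μ hμ => ?_))
  -- The division by `|Γ|` in the definition of the orbifold volume is not exploited.
  have h1 : (1 : ℝ≥0∞) ≤ Nat.card Γ := by exact_mod_cast hk
  refine (ENNReal.div_le_of_le_mul' ?_ :
    pullbackVolume Γ (fun p => μ (orbifoldSortedMap e r p)) ≤ _)
  refine (lintegral_volumeDensity_sortedMap_le e r hμ).trans (le_trans (le_of_eq ?_)
    (le_mul_of_one_le_left' h1))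
  rw [volumeConstant]
  push_cast
  rw [mul_pow, ← sq, ← pow_mul]
  ring

end PCVolume

end

theorem mainTheorem3 :
    ∃ C : ℕ → ℝ≥0, ∀ (n : ℕ) (Γ : Subgroup (PCVolume.Orth n)), Finite Γ →
      Filter.Tendsto (fun N : ℕ => PCVolume.dimPCVolume N Γ) Filter.atTop
        (𝓝 (PCVolume.pcVolume Γ)) ∧
      PCVolume.pcVolume Γ < (C n : ℝ≥0∞) * (Nat.card Γ : ℝ≥0∞) ^ (2 * n) := by
  refine ⟨fun n => (PCVolume.volumeConstant n).toNNReal + 1, fun n Γ hΓ => ⟨?_, ?_⟩⟩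
  · rw [PCVolume.pcVolume_eq_iInf]
    exact PCVolume.tendsto_dimPCVolume Γ
  · have hk : (Nat.card Γ : ℝ≥0∞) ≠ 0 := by exact_mod_cast Nat.card_pos.ne'
    refine (PCVolume.pcVolume_le Γ).trans_lt ?_
    rw [ENNReal.coe_add, ENNReal.coe_toNNReal (PCVolume.volumeConstant_ne_top n)]
    refine (ENNReal.mul_lt_mul_iff_left (pow_ne_zero _ hk) (by finiteness)).2 ?_
    exact ENNReal.lt_add_right (PCVolume.volumeConstant_ne_top n) one_ne_zero
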